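/- Let $d\ge 1$ and let $\{\psi_\lambda\}_{\lambda\in\Lambda}$ be an (inhomogeneous) orthonormal wavelet basis of $L_2=L_2(\mathbb R^d)$ consisting of real Schwartz functions; $|\lambda|$ denotes the level of $\lambda$. For $s\in\mathbb R$ and $p>0$ let $B^s_p$ be the space of real tempered distributions $u$ on $\mathbb R^d$ with $$\|u\|_{B^s_p}^p:=\sum_{\lambda\in\Lambda}2^{p(s+d(\frac12-\frac1p))|\lambda|}\,|\langle u,\psi_\lambda\rangle|^p<\infty ,$$ and put $\|u\|_{B^s_p}=\infty$ for $u\notin B^s_p$. Let $H^s:=B^s_2$. Let $\eta>0$ and $0<\varepsilon<\eta/3$, and let $F:H^{-\eta}\to L_2$ be linear and continuous with $\operatorname{rg}F^*=H^\eta$ (where $F^*w$, $w\in L_2$, is regarded as the tempered distribution $\varphi\mapsto\langle w,F\varphi\rangle_{L_2}$). For $u^\dagger\in H^{-\eta}$ and a space $\mathcal B_R=B^{s_R}_{p_R}$, let $u^{\alpha,\delta}$ denote any minimizer over $H^{-\eta}$ of $$T_\alpha(u)=\|Fu-v^\delta\|_{L_2}^2+\alpha\,\|u\|_{\mathcal B_R}^{p_R},\qquad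 \|v^\delta-Fu^\dagger\|_{L_2}\le\delta,$$ with parameter rule $\alpha\asymp\delta$. For a source condition $u^\dagger\in B^{s_S}_{p_S}$ and $\operatorname{rg}F^*=B^{s_G}_{p_G}$ consider the parameter choice $$p_R=\frac{p_S+p_G}{p_G},\qquad s_R\le\frac{p_Ss_S-p_Gs_G}{p_S+p_G},\qquad \sigma=s_R+d\Big(\frac12-\frac1{p_R}\Big). \tag{$*$}$$ 1. (Loose source condition.) For $\mathcal B_S=H^\eta$ (which is continuously embedded in $H^{-\eta}$) the choice $(*)$, with $s_G=\eta$ and $p_G=2$, gives $p_R=2$ and the maximal value $s_R=0$, i.e. $\mathcal B_R=H^0=L_2$ (with equal norms), and the largest $\sigma$ allowed by $(*)$ is $\sigma=0$. If $u^\dagger\in H^\eta$, then for this penalty $$\|u^{\alpha,\delta}-u^\dagger\|_{L_2}=\mathcal O(\sqrt\delta)\qquad(\delta\to0).$$ 2. (Tighter source condition.) The space $B_1^{\eta+d/2+3\varepsilon}$ is continuously embedded in $H^\eta$ and is a proper subspace of it. For $\mathcal B_S=B_1^{\eta+d/2+3\varepsilon}$ the choice $(*)$, with $s_G=\eta$ and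 $p_G=2$, gives $p_R=\frac32$ and the maximal value $s_R=-\frac\eta3+\varepsilon+\frac d6$, i.e. $\mathcal B_R=B_{3/2}^{-\eta/3+\varepsilon+d/6}$, and the largest $\sigma$ allowed by $(*)$ is $\sigma=-\frac\eta3+\varepsilon$. If $u^\dagger\in B_1^{\eta+d/2+3\varepsilon}$, then for this penalty $$\|u^{\alpha,\delta}-u^\dagger\|_{H^{-\eta/3+\varepsilon}}=\mathcal O(\sqrt\delta)\qquad(\delta\to0).$$ 3. $L_2$ is continuously embedded in $H^{-\eta/3+\varepsilon}$ and is a proper subspace of it. So with the choice $(*)$ the tighter source condition is guaranteed a rate only in a strictly larger space, i.e. in a weaker norm, than the loose source condition. -/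

import Mathlib

open MeasureTheory
open scoped ENNReal NNReal SchwartzMap

noncomputable section

namespace BesovTikhonov

/-- The Euclidean space `ℝ^d`. -/
abbrev Pt (d : ℕ) : Type := EuclideanSpace ℝ (Fin d)

/-- The real Hilbert space `L_2(ℝ^d)`. -/
abbrev L2 (d : ℕ) : Type := Lp ℝ 2 (volume : Measure (Pt d))

/-- Real tempered distributions on `ℝ^d`: continuous linear functionals on real-valued Schwartz
functions. -/
abbrev Distr (d : ℕ) : Type := 𝓢(Pt d, ℝ) →L[ℝ] ℝ

/-- The tempered distribution `χ ↦ ∫ f χ` of a function `f ∈ L_2`. -/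
def ofL2 {d : ℕ} (f : L2 d) : Distr d :=
  (innerSL ℝ f).comp (SchwartzMap.toLpCLM ℝ ℝ 2 (volume : Measure (Pt d)))

/-- The `L_2` norm of a tempered distribution; it is `∞` if the distribution is not (given by) an
`L_2` function. -/
def l2Norm {d : ℕ} (u : Distr d) : ℝ≥0∞ :=
  ⨅ (f : L2 d) (_ : u = ofL2 f), ‖f‖ₑ

/-! ### Wavelets -/

/-- Indices `λ` of an inhomogeneous wavelet basis of `L_2(ℝ^d)`: translates `k ∈ ℤ^d` of the father
wavelet, and dilation levels `j ≥ 0`, types `1, …, 2^d - 1` and translates `k ∈ ℤ^d` of the mother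
wavelets. -/
abbrev Index (d : ℕ) : Type := (Fin d → ℤ) ⊕ (ℕ × Fin (2 ^ d - 1) × (Fin d → ℤ))

/-- The level `|λ|`. -/
def Index.level {d : ℕ} : Index d → ℕ
  | Sum.inl _ => 0
  | Sum.inr l => l.1

/-- The integer point `k ∈ ℤ^d` as a point of `ℝ^d`. -/
def intPt {d : ℕ} (k : Fin d → ℤ) : Pt d := WithLp.toLp 2 fun i => (k i : ℝ)

lemma antilipschitz_dilate {d : ℕ} (j : ℕ) (a : Pt d) :
    AntilipschitzWith 1 fun x : Pt d => (2 : ℝ) ^ j • x - a := by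
  apply AntilipschitzWith.of_le_mul_dist
  intro x y
  have h : (1 : ℝ) ≤ 2 ^ j := one_le_pow₀ (by norm_num)
  rw [NNReal.coe_one, one_mul, dist_sub_right, dist_smul₀, norm_pow, Real.norm_ofNat]
  exact le_mul_of_one_le_left dist_nonneg h

/-- The function `x ↦ 2^{jd/2} f(2^j x - k)`. -/
def dilate {d : ℕ} (f : 𝓢(Pt d, ℝ)) (j : ℕ) (k : Fin d → ℤ) : 𝓢(Pt d, ℝ) :=
  ((2 : ℝ) ^ ((j : ℝ) * d / 2)) •
    SchwartzMap.compCLMOfAntilipschitz ℝ (g := fun x : Pt d => (2 : ℝ) ^ j • x - intPt k)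
      (by fun_prop) (antilipschitz_dilate j (intPt k)) f

lemma dilate_apply {d : ℕ} (f : 𝓢(Pt d, ℝ)) (j : ℕ) (k : Fin d → ℤ) (x : Pt d) :
    dilate f j k x = (2 : ℝ) ^ ((j : ℝ) * d / 2) * f ((2 : ℝ) ^ j • x - intPt k) := rfl

/-- The family `ψ_λ` generated by a father wavelet `φ` and mother wavelets `ψ_i`. -/
def waveletFamily {d : ℕ} (father : 𝓢(Pt d, ℝ)) (mother : Fin (2 ^ d - 1) → 𝓢(Pt d, ℝ)) :
    Index d → 𝓢(Pt d, ℝ)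
  | Sum.inl k => dilate father 0 k
  | Sum.inr (j, i, k) => dilate (mother i) j k

/-- An orthonormal wavelet basis of `L_2(ℝ^d)` consisting of Schwartz functions
(for instance the Meyer wavelets). -/
structure WaveletSystem (d : ℕ) where
  father : 𝓢(Pt d, ℝ)
  mother : Fin (2 ^ d - 1) → 𝓢(Pt d, ℝ)
  orthonormal : Orthonormal ℝ fun l : Index d => ((waveletFamily father mother l).toLp 2 : L2 d)
  complete : ⊤ ≤ (Submodule.span ℝ (Set.range fun l : Index d =>
    ((waveletFamily father mother l).toLp 2 : L2 d))).topologicalClosure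

/-- The wavelet `ψ_λ`. -/
def WaveletSystem.fn {d : ℕ} (W : WaveletSystem d) (l : Index d) : 𝓢(Pt d, ℝ) :=
  waveletFamily W.father W.mother l

/-! ### Besov spaces -/

/-- `‖u‖_{B^s_p}^p = ∑_λ 2^{p (s + d (1/2 - 1/p)) |λ|} |u_λ|^p`, where `u_λ = ⟨u, ψ_λ⟩`. -/
def besovPow {d : ℕ} (W : WaveletSystem d) (s p : ℝ) (u : Distr d) : ℝ≥0∞ :=
  ∑' l : Index d, ENNReal.ofReal
    ((2 : ℝ) ^ (p * (s + d * (1 / 2 - 1 / p)) * (l.level : ℝ)) * |u (W.fn l)| ^ p)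

/-- `‖u‖_{B^s_p}`. -/
def besovNorm {d : ℕ} (W : WaveletSystem d) (s p : ℝ) (u : Distr d) : ℝ≥0∞ :=
  besovPow W s p u ^ (1 / p)

/-- `u = ∑_λ u_λ ψ_λ` in the sense of tempered distributions. (Every tempered distribution has this
expansion, because the wavelet expansion of a Schwartz function converges in the Schwartz space.) -/
def HasWaveletExpansion {d : ℕ} (W : WaveletSystem d) (u : Distr d) : Prop :=
  ∀ χ : 𝓢(Pt d, ℝ),
    HasSum (fun l : Index d => u (W.fn l) * inner ℝ ((W.fn l).toLp 2 : L2 d) (χ.toLp 2)) (u χ)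

lemma abs_add_rpow_le {p : ℝ} (hp : 0 < p) (a b : ℝ) :
    |a + b| ^ p ≤ 2 ^ p * (|a| ^ p + |b| ^ p) := by
  have ha := abs_nonneg a
  have hb := abs_nonneg b
  have h1 : |a + b| ≤ 2 * max |a| |b| := by
    have := abs_add_le a b
    have := le_max_left |a| |b|
    have := le_max_right |a| |b|
    linarith
  calc |a + b| ^ p ≤ (2 * max |a| |b|) ^ p :=
        Real.rpow_le_rpow (abs_nonneg _) h1 hp.le
    _ = 2 ^ p * (max |a| |b|) ^ p := Real.mul_rpow (by norm_num) (le_max_of_le_left ha)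
    _ ≤ 2 ^ p * (|a| ^ p + |b| ^ p) := by
        gcongr
        rcases max_choice |a| |b| with h | h <;> rw [h]
        · exact le_add_of_nonneg_right (by positivity)
        · exact le_add_of_nonneg_left (by positivity)

/-- The Besov space `B^s_p = B^s_{p,p}(ℝ^d)`. -/
def besov {d : ℕ} (W : WaveletSystem d) (s p : ℝ) (hp : 0 < p) : Submodule ℝ (Distr d) where
  carrier := {u | HasWaveletExpansion W u ∧ besovPow W s p u < ∞}
  zero_mem' := by
    refine ⟨fun χ => ?_, ?_⟩
    · simp
    · simp [besovPow, Real.zero_rpow hp.ne']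
  add_mem' := by
    rintro u v ⟨hu, hu'⟩ ⟨hv, hv'⟩
    refine ⟨fun χ => ?_, ?_⟩
    · simpa [add_mul] using (hu χ).add (hv χ)
    · have h : besovPow W s p (u + v) ≤
          ENNReal.ofReal (2 ^ p) * (besovPow W s p u + besovPow W s p v) := by
        unfold besovPow
        rw [← ENNReal.tsum_add, ← ENNReal.tsum_mul_left]
        refine ENNReal.tsum_le_tsum fun l => ?_
        rw [← ENNReal.ofReal_add (by positivity) (by positivity),
          ← ENNReal.ofReal_mul (by positivity)]
        refine ENNReal.ofReal_le_ofReal ?_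
        rw [← mul_add, mul_left_comm, add_apply]
        gcongr
        exact abs_add_rpow_le hp _ _
      exact h.trans_lt (ENNReal.mul_lt_top ENNReal.ofReal_lt_top (ENNReal.add_lt_top.2 ⟨hu', hv'⟩))
  smul_mem' := by
    rintro c u ⟨hu, hu'⟩
    refine ⟨fun χ => ?_, ?_⟩
    · simpa [mul_assoc] using (hu χ).mul_left c
    · have h : besovPow W s p (c • u) = ENNReal.ofReal (|c| ^ p) * besovPow W s p u := by
        unfold besovPow
        rw [← ENNReal.tsum_mul_left]
        refine tsum_congr fun l => ?_
        rw [← ENNReal.ofReal_mul (by positivity)]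
        congr 1
        simp only [smul_apply, smul_eq_mul, abs_mul]
        rw [Real.mul_rpow (abs_nonneg _) (abs_nonneg _)]
        ring
      change besovPow W s p (c • u) < ∞
      rw [h]
      exact ENNReal.mul_lt_top ENNReal.ofReal_lt_top hu'

/-- The Sobolev space `H^s = B^s_2`. -/
abbrev sobolev {d : ℕ} (W : WaveletSystem d) (s : ℝ) : Submodule ℝ (Distr d) :=
  besov W s 2 two_pos

/-- `B^{s₁}_{p₁} ⊂ B^{s₂}_{p₂}` with continuous embedding. -/
def ContEmbeds {d : ℕ} (W : WaveletSystem d) (s₁ p₁ : ℝ) (hp₁ : 0 < p₁) (s₂ p₂ : ℝ)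
    (hp₂ : 0 < p₂) : Prop :=
  besov W s₁ p₁ hp₁ ≤ besov W s₂ p₂ hp₂ ∧
    ∃ C : ℝ≥0, ∀ u ∈ besov W s₁ p₁ hp₁, besovNorm W s₂ p₂ u ≤ C * besovNorm W s₁ p₁ u

/-- Every `L_2` function belongs to `H^s` for `s ≤ 0`. In particular the domains `H^{-η}` contain
all Schwartz functions. -/
lemma ofL2_mem_sobolev {d : ℕ} (W : WaveletSystem d) {s : ℝ} (hs : s ≤ 0) (f : L2 d) :
    ofL2 f ∈ sobolev W s := by
  have e : ∀ χ : 𝓢(Pt d, ℝ), ofL2 f χ = inner ℝ f (χ.toLp 2 : L2 d) := fun χ => rfl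
  refine ⟨fun χ => ?_, ?_⟩
  · have h := (HilbertBasis.mk W.orthonormal W.complete).hasSum_inner_mul_inner f (χ.toLp 2)
    simp only [HilbertBasis.coe_mk] at h
    exact h
  · have hS := W.orthonormal.inner_products_summable f
    refine lt_of_le_of_lt (ENNReal.tsum_le_tsum fun l => ENNReal.ofReal_le_ofReal ?_)
      hS.tsum_ofReal_lt_top
    rw [e, real_inner_comm, Real.norm_eq_abs, Real.rpow_two]
    refine mul_le_of_le_one_left (by positivity) ?_
    refine Real.rpow_le_one_of_one_le_of_nonpos (by norm_num) ?_
    have : (0 : ℝ) ≤ l.level := Nat.cast_nonneg _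
    have h2 : (2 : ℝ) * (s + d * (1 / 2 - 1 / 2)) ≤ 0 := by linarith
    exact mul_nonpos_of_nonpos_of_nonneg h2 this

/-! ### Tikhonov regularization -/

/-- The range of the adjoint `F^*` of a bounded operator `F : 𝓑_D → L_2`, as a set of tempered
distributions: `F^* w` is the distribution `φ ↦ ⟨w, F φ⟩_{L_2}`. -/
def adjointRange {d : ℕ} {D : Submodule ℝ (Distr d)} (F : D →ₗ[ℝ] L2 d) : Set (Distr d) :=
  {T | ∃ w : L2 d, ∀ φ : 𝓢(Pt d, ℝ), ∀ u : D, (u : Distr d) = ofL2 (φ.toLp 2) →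
    T φ = inner ℝ w (F u)}

/-- The Tikhonov functional `T_α(u) = ‖F u - v‖² + α ‖u‖_{B^{s_R}_{p_R}}^{p_R}` on `𝓑_D`. It is `∞`
for `u ∉ B^{s_R}_{p_R}`. -/
def tikhonov {d : ℕ} (W : WaveletSystem d) {D : Submodule ℝ (Distr d)} (F : D →ₗ[ℝ] L2 d)
    (sR pR α : ℝ) (v : L2 d) (u : D) : ℝ≥0∞ :=
  ENNReal.ofReal (‖F u - v‖ ^ 2) + ENNReal.ofReal α * besovPow W sR pR (u : Distr d)

/-- With the penalty `‖·‖_{B^{s_R}_{p_R}}^{p_R}` and a parameter rule `α ≍ δ`, all minimizers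
`u^{α,δ}` of the Tikhonov functional for data `v^δ` with `‖v^δ - F u†‖ ≤ δ` satisfy
`N (u^{α,δ} - u†) = O(√δ)` as `δ → 0`. -/
def ConvergesAtRateSqrt {d : ℕ} (W : WaveletSystem d) {D : Submodule ℝ (Distr d)}
    (F : D →ₗ[ℝ] L2 d) (sR pR : ℝ) (N : Distr d → ℝ≥0∞) (u₀ : D) : Prop :=
  ∀ c C : ℝ, 0 < c → ∃ K δ₀ : ℝ, 0 < δ₀ ∧
    ∀ δ : ℝ, 0 < δ → δ ≤ δ₀ → ∀ α : ℝ, c * δ ≤ α → α ≤ C * δ →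
      ∀ v : L2 d, ‖v - F u₀‖ ≤ δ →
        ∀ u : D, (∀ u' : D, tikhonov W F sR pR α v u ≤ tikhonov W F sR pR α v u') →
          N ((u : Distr d) - (u₀ : Distr d)) ≤ ENNReal.ofReal (K * Real.sqrt δ)

/-! ### The parameters of the general rate theorem -/

/-- The integrability `p_R = (p_S + p_G) / p_G` of the penalty. -/
def penaltyIntegrability (pS pG : ℝ) : ℝ := (pS + pG) / pG

/-- The upper bound `(p_S s_S - p_G s_G) / (p_S + p_G)` for the smoothness `s_R` of the penalty. -/
def maxPenaltySmoothness (sS pS sG pG : ℝ) : ℝ := (pS * sS - pG * sG) / (pS + pG)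

/-- The smoothness `σ = s_R + d (1/2 - 1/p_R)` of the Sobolev space `H^σ` of the rate. -/
def rateSmoothness (d : ℕ) (sR pR : ℝ) : ℝ := sR + d * (1 / 2 - 1 / pR)

/-- All smoothness indices `σ` in which the source condition `u† ∈ B^{s_S}_{p_S}` and
`rg F^* = B^{s_G}_{p_G}` give a rate, when `s_R` runs through its admissible values. -/
def guaranteedSmoothness (d : ℕ) (sS pS sG pG : ℝ) : Set ℝ :=
  {σ | ∃ sR ≤ maxPenaltySmoothness sS pS sG pG,
    σ = rateSmoothness d sR (penaltyIntegrability pS pG)}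

end BesovTikhonov

end

/-! Both rates follow one scheme. Let `R` be the penalty and suppose its subgradient `ξ` at `u†`
equals `F^* w`. Comparing a minimizer `u` with `u†` and completing a square bounds the Bregman
distance `R(u) - R(u†) - ⟨ξ, u - u†⟩` by `(δ + α‖w‖)² / α = O(δ)`. If this distance dominates `‖u -
u†‖²` in `H^σ`, the rate `√δ` follows. All quantities are sums over wavelet coefficients, so the
domination is a scalar inequality (`convergesAtRateSqrt_of_coeff`). For the `L_2` penalty, `ξ = 2u†`
and the scalar inequality is an identity. For `p_R = 3/2` it is local uniform convexity of
`|·|^{3/2}` (`sq_le_bregman_three_halves`). There `|ξ_λ|²` is proportional to `2^{3σ|λ|}|u†_λ|`, and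
`2η + 3σ = η + 3ε`, so `u† ∈ B_1^{η+d/2+3ε}` puts `ξ` in `H^η = rg F^*`. Strictness of the
embeddings is witnessed by lacunary series with one wavelet per level. -/

noncomputable section

namespace BesovTikhonov

variable {d : ℕ} {W : WaveletSystem d}

/-! ### Wavelet coefficients -/

/-- The contribution of a wavelet coefficient `x` at index `l` to `‖·‖_{B^s_p}^p`. -/
def besovTerm (s p : ℝ) (l : Index d) (x : ℝ) : ℝ :=
  (2 : ℝ) ^ (p * (s + d * (1 / 2 - 1 / p)) * (l.level : ℝ)) * |x| ^ p

lemma besovTerm_nonneg (s p : ℝ) (l : Index d) (x : ℝ) : 0 ≤ besovTerm s p l x := by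
  unfold besovTerm; positivity

lemma besovTerm_two (s : ℝ) (l : Index d) (x : ℝ) :
    besovTerm s 2 l x = ((2 : ℝ) ^ (s * (l.level : ℝ)) * x) ^ 2 := by
  unfold besovTerm
  rw [Real.rpow_two, sq_abs, mul_pow, ← Real.rpow_natCast ((2 : ℝ) ^ _),
    ← Real.rpow_mul (by norm_num)]
  congr 2
  push_cast
  ring

lemma besovPow_lt_top_iff {s p : ℝ} {u : Distr d} :
    besovPow W s p u < ∞ ↔ Summable fun l => besovTerm s p l (u (W.fn l)) := by
  constructor
  · intro h
    refine (ENNReal.summable_toReal h.ne).congr fun l => ?_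
    exact ENNReal.toReal_ofReal (besovTerm_nonneg _ _ _ _)
  · exact fun h => h.tsum_ofReal_lt_top

lemma besovPow_eq_ofReal {s p : ℝ} {u : Distr d}
    (h : Summable fun l => besovTerm s p l (u (W.fn l))) :
    besovPow W s p u = ENNReal.ofReal (∑' l, besovTerm s p l (u (W.fn l))) :=
  (ENNReal.ofReal_tsum_of_nonneg (fun _ => besovTerm_nonneg _ _ _ _) h).symm

lemma mem_sobolev_iff {s : ℝ} {u : Distr d} :
    u ∈ sobolev W s ↔ HasWaveletExpansion W u ∧
      Summable fun l : Index d => ((2 : ℝ) ^ (s * (l.level : ℝ)) * u (W.fn l)) ^ 2 := by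
  simp_rw [← besovTerm_two, ← besovPow_lt_top_iff]
  rfl

lemma HasWaveletExpansion.eq_of_coeff {u v : Distr d} (hu : HasWaveletExpansion W u)
    (hv : HasWaveletExpansion W v) (h : ∀ l, u (W.fn l) = v (W.fn l)) : u = v := by
  ext χ
  refine (hu χ).unique ?_
  simpa only [h] using hv χ

/-- The wavelets as a Hilbert basis of `L_2`. -/
def WaveletSystem.basis (W : WaveletSystem d) : HilbertBasis (Index d) ℝ (L2 d) :=
  HilbertBasis.mk W.orthonormal W.complete

lemma WaveletSystem.basis_apply (W : WaveletSystem d) (l : Index d) :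
    W.basis l = ((W.fn l).toLp 2 : L2 d) := by
  rw [WaveletSystem.basis, HilbertBasis.coe_mk]; rfl

lemma ofL2_apply (f : L2 d) (χ : 𝓢(Pt d, ℝ)) : ofL2 f χ = inner ℝ f (χ.toLp 2 : L2 d) := rfl

lemma ofL2_apply_fn (f : L2 d) (l : Index d) : ofL2 f (W.fn l) = W.basis.repr f l := by
  rw [HilbertBasis.repr_apply_apply, W.basis_apply, real_inner_comm, ofL2_apply]

lemma hasWaveletExpansion_ofL2 (f : L2 d) : HasWaveletExpansion W (ofL2 f) :=
  (ofL2_mem_sobolev W le_rfl f).1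

lemma inner_fn_fn [DecidableEq (Index d)] (l m : Index d) :
    inner ℝ ((W.fn l).toLp 2 : L2 d) ((W.fn m).toLp 2) = if l = m then (1 : ℝ) else 0 :=
  orthonormal_iff_ite.1 W.orthonormal l m

lemma exists_ofL2_of_summable_sq {c : Index d → ℝ} (hc : Summable fun l => c l ^ 2) :
    ∃ f : L2 d, ∀ l, ofL2 f (W.fn l) = c l := by
  have hm : Memℓp c 2 := by
    rw [memℓp_gen_iff (by norm_num)]
    simpa using hc
  refine ⟨W.basis.repr.symm ⟨c, hm⟩, fun l => ?_⟩
  rw [ofL2_apply_fn, LinearIsometryEquiv.apply_symm_apply]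

lemma besovNorm_ofL2 (f : L2 d) : besovNorm W 0 2 (ofL2 f) = ‖f‖ₑ := by
  have h : HasSum (fun l => besovTerm 0 2 l (ofL2 f (W.fn l))) (‖f‖ ^ 2) := by
    have := W.basis.hasSum_inner_mul_inner f f
    rw [real_inner_self_eq_norm_sq] at this
    convert! this using 2 with l
    rw [besovTerm_two, ofL2_apply, W.basis_apply, real_inner_comm f]
    simp [sq]
  rw [besovNorm, besovPow_eq_ofReal h.summable, h.tsum_eq, ENNReal.ofReal_rpow_of_nonneg
    (by positivity) (by norm_num), ← Real.sqrt_eq_rpow, Real.sqrt_sq (norm_nonneg _),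
    ofReal_norm]

lemma ofL2_injective (W : WaveletSystem d) : Function.Injective (ofL2 : L2 d → Distr d) := by
  intro f g h
  apply W.basis.repr.injective
  ext l
  rw [← ofL2_apply_fn, ← ofL2_apply_fn, h]

lemma l2Norm_ofL2 (W : WaveletSystem d) (f : L2 d) : l2Norm (ofL2 f) = ‖f‖ₑ := by
  refine le_antisymm (iInf₂_le_of_le f rfl le_rfl) (le_iInf₂ fun g hg => ?_)
  rw [ofL2_injective W hg]

lemma mem_sobolev_zero_iff {u : Distr d} : u ∈ sobolev W 0 ↔ ∃ f : L2 d, u = ofL2 f := by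
  constructor
  · intro h
    obtain ⟨h1, h2⟩ := mem_sobolev_iff.1 h
    obtain ⟨f, hf⟩ := exists_ofL2_of_summable_sq (W := W) (by simpa using h2)
    exact ⟨f, h1.eq_of_coeff (hasWaveletExpansion_ofL2 f) fun l => (hf l).symm⟩
  · rintro ⟨f, rfl⟩
    exact ofL2_mem_sobolev W le_rfl f

lemma mem_sobolev_zero_iff_l2Norm_lt_top {u : Distr d} : u ∈ sobolev W 0 ↔ l2Norm u < ∞ := by
  rw [mem_sobolev_zero_iff]
  constructor
  · rintro ⟨f, rfl⟩
    rw [l2Norm_ofL2 W]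
    exact enorm_lt_top
  · intro h
    simp only [l2Norm, iInf_lt_iff] at h
    obtain ⟨f, hf, -⟩ := h
    exact ⟨f, hf⟩

lemma besovNorm_eq_l2Norm {u : Distr d} (hu : u ∈ sobolev W 0) :
    besovNorm W 0 2 u = l2Norm u := by
  obtain ⟨f, rfl⟩ := mem_sobolev_zero_iff.1 hu
  rw [besovNorm_ofL2, l2Norm_ofL2 W]

/-! ### Embeddings -/

lemma besovPow_mono {s t p : ℝ} (hp : 0 < p) (hst : s ≤ t) (u : Distr d) :
    besovPow W s p u ≤ besovPow W t p u := by
  refine ENNReal.tsum_le_tsum fun l => ENNReal.ofReal_le_ofReal ?_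
  gcongr
  norm_num

lemma contEmbeds_of_le {s t p : ℝ} (hp : 0 < p) (hst : s ≤ t) :
    ContEmbeds W t p hp s p hp := by
  refine ⟨fun u hu => ⟨hu.1, (besovPow_mono hp hst u).trans_lt hu.2⟩, 1, fun u _ => ?_⟩
  rw [ENNReal.coe_one, one_mul]
  exact ENNReal.rpow_le_rpow (besovPow_mono hp hst u) (by positivity)

lemma tsum_sq_le_sq_tsum {ι : Type*} (f : ι → ℝ≥0∞) : ∑' i, f i ^ 2 ≤ (∑' i, f i) ^ 2 := by
  rw [sq, ← ENNReal.tsum_mul_right]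
  refine ENNReal.tsum_le_tsum fun i => ?_
  rw [sq]
  gcongr
  exact ENNReal.le_tsum i

/-- For `p = 1` the weight exponent is `t - d/2 ≥ s`, so this is the inclusion of `ℓ¹` in `ℓ²` for
weighted coefficients. -/
lemma besovNorm_two_le_besovNorm_one {s t : ℝ} (hst : s + d / 2 ≤ t) (u : Distr d) :
    besovNorm W s 2 u ≤ besovNorm W t 1 u := by
  have h : besovPow W s 2 u ≤ besovPow W t 1 u ^ 2 := by
    refine le_trans (ENNReal.tsum_le_tsum fun l => ?_) (tsum_sq_le_sq_tsum _)
    rw [← ENNReal.ofReal_pow (by positivity)]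
    refine ENNReal.ofReal_le_ofReal ?_
    change besovTerm s 2 l _ ≤ _
    rw [besovTerm_two, Real.rpow_one, ← sq_abs, abs_mul, abs_of_pos (by positivity)]
    gcongr
    · norm_num
    · linarith
  rw [besovNorm, besovNorm, one_div_one, ENNReal.rpow_one]
  calc besovPow W s 2 u ^ ((1 : ℝ) / 2) ≤ (besovPow W t 1 u ^ 2) ^ ((1 : ℝ) / 2) := by gcongr
    _ = besovPow W t 1 u := by
      rw [← ENNReal.rpow_natCast, ← ENNReal.rpow_mul]; norm_num

lemma besovPow_lt_top_of_besovNorm {s p : ℝ} (hp : 0 < p) {u : Distr d}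
    (h : besovNorm W s p u < ∞) : besovPow W s p u < ∞ :=
  (ENNReal.rpow_lt_top_iff_of_pos (by positivity)).1 h

lemma contEmbeds_one_two {s t : ℝ} (hst : s + d / 2 ≤ t) :
    ContEmbeds W t 1 one_pos s 2 two_pos := by
  refine ⟨fun u hu => ⟨hu.1, besovPow_lt_top_of_besovNorm two_pos ?_⟩, 1, fun u _ => ?_⟩
  · refine (besovNorm_two_le_besovNorm_one hst u).trans_lt ?_
    exact (ENNReal.rpow_lt_top_iff_of_pos (by norm_num)).2 hu.2
  · rw [ENNReal.coe_one, one_mul]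
    exact besovNorm_two_le_besovNorm_one hst u

/-! ### Operators on Sobolev spaces -/

/-- The wavelet `ψ_λ` as an element of `H^s`, `s ≤ 0`. -/
def WaveletSystem.elt (W : WaveletSystem d) {s : ℝ} (hs : s ≤ 0) (l : Index d) : sobolev W s :=
  ⟨ofL2 ((W.fn l).toLp 2), ofL2_mem_sobolev W hs _⟩

lemma sub_partialSum_apply [DecidableEq (Index d)] {s : ℝ} (hs : s ≤ 0) (h : sobolev W s)
    (t : Finset (Index d)) (m : Index d) :
    ((h - ∑ l ∈ t, (h : Distr d) (W.fn l) • W.elt hs l : sobolev W s) : Distr d) (W.fn m) =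
      if m ∈ t then 0 else (h : Distr d) (W.fn m) := by
  have e : ∀ l, ((W.elt hs l : sobolev W s) : Distr d) (W.fn m) = if l = m then 1 else 0 :=
    fun l => inner_fn_fn l m
  simp only [Submodule.coe_sub, Submodule.coe_sum, Submodule.coe_smul, sub_apply, sum_apply,
    smul_apply, e, smul_eq_mul, mul_ite, mul_one, mul_zero, Finset.sum_ite_eq']
  split_ifs <;> simp

/-- Subtracting a partial sum deletes its coefficients by orthonormality; what remains is the tail
of a convergent series. -/
lemma besovPow_sub_partialSum_tendsto {s : ℝ} (hs : s ≤ 0) (h : sobolev W s) :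
    Filter.Tendsto (fun t : Finset (Index d) => besovPow W s 2
      ((h - ∑ l ∈ t, (h : Distr d) (W.fn l) • W.elt hs l : sobolev W s) : Distr d))
      Filter.atTop (nhds 0) := by
  classical
  have key := ENNReal.tendsto_tsum_compl_atTop_zero
    (f := fun l => ENNReal.ofReal (besovTerm s 2 l ((h : Distr d) (W.fn l)))) h.2.2.ne
  refine key.congr fun t => ?_
  refine (tsum_subtype {l | l ∉ t} fun l =>
    ENNReal.ofReal (besovTerm s 2 l ((h : Distr d) (W.fn l)))).trans (tsum_congr fun l => ?_)
  rw [sub_partialSum_apply]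
  by_cases hl : l ∈ t
  · simp [hl]
  · rw [Set.indicator_of_mem (by exact hl), if_neg hl]
    rfl

/-- `adjointRange` only tests against Schwartz functions. Density of wavelet sums and continuity of
`F` carry the identity to the whole domain. -/
lemma hasSum_map_wavelets {s : ℝ} (hs : s ≤ 0) {F : sobolev W s →ₗ[ℝ] L2 d}
    (hF : ∃ C : ℝ≥0, ∀ u, ‖F u‖ₑ ≤ C * besovNorm W s 2 u) (h : sobolev W s) :
    HasSum (fun l => (h : Distr d) (W.fn l) • F (W.elt hs l)) (F h) := by
  obtain ⟨C, hC⟩ := hF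
  rw [HasSum, SummationFilter.unconditional_filter, tendsto_iff_edist_tendsto_0]
  have h1 := ((ENNReal.continuous_rpow_const (y := 1 / 2)).tendsto 0).comp
    (besovPow_sub_partialSum_tendsto hs h)
  have h2 := ENNReal.Tendsto.const_mul (a := (C : ℝ≥0∞)) h1 (Or.inr ENNReal.coe_ne_top)
  rw [ENNReal.zero_rpow_of_pos (by norm_num), mul_zero] at h2
  refine tendsto_of_tendsto_of_tendsto_of_le_of_le tendsto_const_nhds h2
    (fun _ => zero_le) fun t => ?_
  rw [edist_comm, edist_eq_enorm_sub]
  simp_rw [← map_smul]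
  rw [← map_sum, ← map_sub]
  exact hC _

/-- If `ξ` belongs to the range of the adjoint, then it pairs with the elements of the domain. -/
lemma exists_hasSum_of_mem_adjointRange {s : ℝ} (hs : s ≤ 0) {F : sobolev W s →ₗ[ℝ] L2 d}
    (hF : ∃ C : ℝ≥0, ∀ u, ‖F u‖ₑ ≤ C * besovNorm W s 2 u) {ξ : Distr d}
    (hξ : ξ ∈ adjointRange F) :
    ∃ w : L2 d, ∀ h : sobolev W s,
      HasSum (fun l => ξ (W.fn l) * (h : Distr d) (W.fn l)) (inner ℝ w (F h)) := by
  obtain ⟨w, hw⟩ := hξ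
  refine ⟨w, fun h => ?_⟩
  have := (hasSum_map_wavelets hs hF h).mapL (innerSL ℝ w)
  simp only [innerSL_apply_apply, inner_smul_right] at this
  convert! this using 2 with l
  rw [hw (W.fn l) (W.elt hs l) rfl, mul_comm]

/-! ### Convergence rates -/

/-- A convergence rate from a lower bound of the Bregman distance of the penalty, coefficient by
coefficient. -/
theorem convergesAtRateSqrt_of_coeff {D : Submodule ℝ (Distr d)} {F : D →ₗ[ℝ] L2 d}
    {sR pR σ : ℝ} {u₀ : D} (h₀ : besovPow W sR pR u₀ < ∞) {ξ : Distr d} {w : L2 d}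
    (hw : ∀ h : D, HasSum (fun l => ξ (W.fn l) * (h : Distr d) (W.fn l)) (inner ℝ w (F h)))
    (hpt : ∀ M : ℝ, ∃ κ : ℝ, 0 ≤ κ ∧ ∀ l : Index d, ∀ b : ℝ, besovTerm sR pR l b ≤ M →
      besovTerm σ 2 l (b - (u₀ : Distr d) (W.fn l)) ≤
        κ * (besovTerm sR pR l b - besovTerm sR pR l ((u₀ : Distr d) (W.fn l)) -
          ξ (W.fn l) * (b - (u₀ : Distr d) (W.fn l)))) :
    ConvergesAtRateSqrt W F sR pR (besovNorm W σ 2) u₀ := by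
  intro c C hc
  have hs₀ := besovPow_lt_top_iff.1 h₀
  have hR₀ := besovPow_eq_ofReal hs₀
  set R₀ := ∑' l, besovTerm sR pR l ((u₀ : Distr d) (W.fn l)) with hR₀'
  have hR₀0 : 0 ≤ R₀ := tsum_nonneg fun _ => besovTerm_nonneg _ _ _ _
  -- Minimality gives `R ≤ 1 / c + R₀` once `δ ≤ 1`, and each single term is at most `R`.
  obtain ⟨κ, hκ, hκ'⟩ := hpt (1 / c + R₀)
  refine ⟨√(κ * ((1 + C * ‖w‖) ^ 2 / c)), 1, one_pos, ?_⟩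
  intro δ hδ hδ1 α hα hαC v hv u hu
  have hα0 : 0 < α := lt_of_lt_of_le (by positivity) hα
  have hu₀ := hu u₀
  have hfin : besovPow W sR pR (u : Distr d) < ∞ := by
    have h1 : ENNReal.ofReal α * besovPow W sR pR (u : Distr d) < ∞ := by
      refine lt_of_le_of_lt (le_add_self.trans hu₀) ?_
      exact ENNReal.add_lt_top.2 ⟨ENNReal.ofReal_lt_top,
        ENNReal.mul_lt_top ENNReal.ofReal_lt_top h₀⟩
    exact ENNReal.lt_top_of_mul_ne_top_right h1.ne (by simpa using hα0)
  have hs := besovPow_lt_top_iff.1 hfin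
  have hR := besovPow_eq_ofReal hs
  set R := ∑' l, besovTerm sR pR l ((u : Distr d) (W.fn l)) with hR'
  have hR0 : 0 ≤ R := tsum_nonneg fun _ => besovTerm_nonneg _ _ _ _
  have hmin : ‖F u - v‖ ^ 2 + α * R ≤ δ ^ 2 + α * R₀ := by
    have h1 : ‖F u - v‖ ^ 2 + α * R ≤ ‖F u₀ - v‖ ^ 2 + α * R₀ := by
      rw [tikhonov, tikhonov, hR, hR₀, ← ENNReal.ofReal_mul hα0.le, ← ENNReal.ofReal_mul hα0.le,
        ← ENNReal.ofReal_add (by positivity) (by positivity),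
        ← ENNReal.ofReal_add (by positivity) (by positivity),
        ENNReal.ofReal_le_ofReal_iff (by positivity)] at hu₀
      exact hu₀
    have h2 : ‖F u₀ - v‖ ^ 2 ≤ δ ^ 2 := by
      rw [norm_sub_rev]
      gcongr
    linarith
  have hRM : R ≤ 1 / c + R₀ := by
    refine le_of_mul_le_mul_left ?_ hα0
    have h1 : δ ≤ α * (1 / c) := by
      rw [mul_one_div, le_div_iff₀ hc]; linarith
    nlinarith [sq_nonneg ‖F u - v‖]
  have hsum : HasSum (fun l => besovTerm sR pR l ((u : Distr d) (W.fn l)) -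
      besovTerm sR pR l ((u₀ : Distr d) (W.fn l)) -
        ξ (W.fn l) * ((u : Distr d) (W.fn l) - (u₀ : Distr d) (W.fn l)))
      (R - R₀ - inner ℝ w (F u - F u₀)) := by
    rw [← map_sub]
    exact (hs.hasSum.sub hs₀.hasSum).sub (hw (u - u₀))
  have hle : ∀ l, besovTerm σ 2 l (((u : Distr d) - u₀) (W.fn l)) ≤
      κ * (besovTerm sR pR l ((u : Distr d) (W.fn l)) -
        besovTerm sR pR l ((u₀ : Distr d) (W.fn l)) -
          ξ (W.fn l) * ((u : Distr d) (W.fn l) - (u₀ : Distr d) (W.fn l))) := fun l =>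
    hκ' l _ ((hs.le_tsum l fun _ _ => besovTerm_nonneg _ _ _ _).trans hRM)
  -- Domination by the Bregman terms also shows that the error lies in `H^σ`.
  have hS := Summable.of_nonneg_of_le (fun _ => besovTerm_nonneg _ _ _ _) hle
    (hsum.mul_left κ).summable
  have hSle := hasSum_le hle hS.hasSum (hsum.mul_left κ)
  have hB : R - R₀ - inner ℝ w (F u - F u₀) ≤ (1 + C * ‖w‖) ^ 2 / c * δ := by
    have h1 : -inner ℝ w (F u - F u₀) ≤ ‖w‖ * (‖F u - v‖ + δ) := by
      rw [← inner_neg_right]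
      refine (real_inner_le_norm _ _).trans ?_
      gcongr
      rw [norm_neg, ← sub_add_sub_cancel _ v]
      exact (norm_add_le _ _).trans (by gcongr)
    -- The residual `‖F u - v‖` enters as `-t² + α‖w‖t`, which is at most `(α‖w‖)² / 4`.
    have h2 : α * (R - R₀ - inner ℝ w (F u - F u₀)) ≤ (δ + α * ‖w‖) ^ 2 := by
      have := mul_le_mul_of_nonneg_left h1 hα0.le
      nlinarith [sq_nonneg (‖F u - v‖ - α * ‖w‖ / 2), sq_nonneg (α * ‖w‖),
        mul_nonneg hδ.le (mul_nonneg hα0.le (norm_nonneg w))]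
    have h3 : (δ + α * ‖w‖) ^ 2 ≤ (δ * (1 + C * ‖w‖)) ^ 2 := by
      gcongr
      nlinarith [mul_le_mul_of_nonneg_right hαC (norm_nonneg w)]
    rw [← mul_le_mul_iff_right₀ hα0]
    refine h2.trans (h3.trans ?_)
    calc (δ * (1 + C * ‖w‖)) ^ 2 = c * δ * ((1 + C * ‖w‖) ^ 2 / c * δ) := by
          field_simp
      _ ≤ α * ((1 + C * ‖w‖) ^ 2 / c * δ) := by gcongr
  rw [besovNorm, besovPow_eq_ofReal hS, ENNReal.ofReal_rpow_of_nonneg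
    (tsum_nonneg fun _ => besovTerm_nonneg _ _ _ _) (by norm_num), ← Real.sqrt_eq_rpow,
    ← Real.sqrt_mul (by positivity), mul_assoc]
  gcongr
  exact hSle.trans (by gcongr)

/-- Here `x = √|A|`, `y = √|B|` with `A`, `B` of equal sign. The Bregman distance of `|·|^{3/2}`
factors as `(y - x)² (y + x/2)`. -/
lemma sq_sub_sq_le_bregman {x y m : ℝ} (hx : 0 ≤ x) (hy : 0 ≤ y) (hxm : x ≤ m) (hym : y ≤ m) :
    (y ^ 2 - x ^ 2) ^ 2 ≤ 4 * m * (y ^ 3 - x ^ 3 - 3 / 2 * x * (y ^ 2 - x ^ 2)) := by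
  have h : (x + y) ^ 2 ≤ 4 * m * (y + x / 2) := by nlinarith
  calc (y ^ 2 - x ^ 2) ^ 2 = (y - x) ^ 2 * (x + y) ^ 2 := by ring
    _ ≤ (y - x) ^ 2 * (4 * m * (y + x / 2)) := by gcongr
    _ = _ := by ring

/-- The case of opposite signs, where `|B - A| = y² + x²`. -/
lemma sq_add_sq_le_bregman {x y m : ℝ} (hx : 0 ≤ x) (hy : 0 ≤ y) (hxm : x ≤ m) (hym : y ≤ m) :
    (y ^ 2 + x ^ 2) ^ 2 ≤ 4 * m * (y ^ 3 - x ^ 3 + 3 / 2 * x * (y ^ 2 + x ^ 2)) := by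
  have h1 : x ^ 4 ≤ m * x ^ 3 := by
    have := mul_le_mul_of_nonneg_right hxm (pow_nonneg hx 3); linarith
  have h2 : y ^ 4 ≤ m * y ^ 3 := by
    have := mul_le_mul_of_nonneg_right hym (pow_nonneg hy 3); linarith
  have h3 : 0 ≤ m * (x * y ^ 2) := by have := hx.trans hxm; positivity
  have h4 : 0 ≤ m * y ^ 3 := by have := hx.trans hxm; positivity
  nlinarith [sq_nonneg (x ^ 2 - y ^ 2)]

lemma abs_rpow_three_halves (A : ℝ) : |A| ^ (3 / 2 : ℝ) = √|A| ^ 3 := by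
  rw [Real.sqrt_eq_rpow, ← Real.rpow_natCast, ← Real.rpow_mul (abs_nonneg A)]
  norm_num

/-- Uniform convexity of `|·|^{3/2}` on bounded sets. -/
lemma sq_le_bregman_three_halves {A B m : ℝ} (hA : √|A| ≤ m) (hB : √|B| ≤ m) :
    (B - A) ^ 2 ≤ 4 * m * (|B| ^ (3 / 2 : ℝ) - |A| ^ (3 / 2 : ℝ) -
      3 / 2 * (Real.sign A * √|A|) * (B - A)) := by
  have hx := Real.sqrt_nonneg |A|
  have hy := Real.sqrt_nonneg |B|
  have hx2 := Real.sq_sqrt (abs_nonneg A)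
  have hy2 := Real.sq_sqrt (abs_nonneg B)
  have h1 := sq_sub_sq_le_bregman hx hy hA hB
  have h2 := sq_add_sq_le_bregman hx hy hA hB
  rw [abs_rpow_three_halves, abs_rpow_three_halves]
  rw [hx2, hy2] at h1 h2
  rcases lt_trichotomy A 0 with hA0 | rfl | hA0
  · rw [Real.sign_of_neg hA0]
    rcases le_total B 0 with hB0 | hB0
    · rw [abs_of_neg hA0, abs_of_nonpos hB0] at *
      linarith
    · rw [abs_of_neg hA0, abs_of_nonneg hB0] at *
      linarith
  · rw [abs_zero, Real.sqrt_zero] at *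
    have := sq_abs B
    linarith
  · rw [Real.sign_of_pos hA0]
    rcases le_total B 0 with hB0 | hB0
    · rw [abs_of_pos hA0, abs_of_nonpos hB0] at *
      linarith
    · rw [abs_of_pos hA0, abs_of_nonneg hB0] at *
      linarith

/-- The Bregman distance of a square is the square of the difference, so `ξ = 2u₀` and `κ = 1` work.
-/
lemma convergesAtRateSqrt_l2 {η : ℝ} (hη : 0 ≤ η) {F : sobolev W (-η) →ₗ[ℝ] L2 d}
    (hF : ∃ C : ℝ≥0, ∀ u, ‖F u‖ₑ ≤ C * besovNorm W (-η) 2 u)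
    (hrg : adjointRange F = (sobolev W η : Set _)) (u₀ : sobolev W (-η))
    (hu₀ : (u₀ : Distr d) ∈ sobolev W η) : ConvergesAtRateSqrt W F 0 2 l2Norm u₀ := by
  have hξ : (2 : ℝ) • (u₀ : Distr d) ∈ adjointRange F := by
    rw [hrg]; exact (sobolev W η).smul_mem 2 hu₀
  obtain ⟨w, hw⟩ := exists_hasSum_of_mem_adjointRange (neg_nonpos.2 hη) hF hξ
  have h₀ : besovPow W 0 2 (u₀ : Distr d) < ∞ :=
    (besovPow_mono two_pos hη _).trans_lt hu₀.2
  have key := convergesAtRateSqrt_of_coeff (σ := 0) h₀ hw fun M => ⟨1, zero_le_one, fun l b _ => by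
    simp only [besovTerm_two, zero_mul, Real.rpow_zero, one_mul, smul_apply, smul_eq_mul]
    exact le_of_eq (by ring)⟩
  intro c C hc
  obtain ⟨K, δ₀, hδ₀, hK⟩ := key c C hc
  refine ⟨K, δ₀, hδ₀, fun δ hδ hδ' α hα hα' v hv u hu => ?_⟩
  have h := hK δ hδ hδ' α hα hα' v hv u hu
  rwa [besovNorm_eq_l2Norm] at h
  exact ⟨(u - u₀).2.1, besovPow_lt_top_of_besovNorm two_pos (h.trans_lt ENNReal.ofReal_lt_top)⟩

/-- The choice `σ = s_R - d/6` makes the penalty and the `H^σ` norm functions of the same weighted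
coefficients. -/
lemma besovTerm_three_halves {sR σ : ℝ} (hσ : σ = sR - d / 6) (l : Index d) (x : ℝ) :
    besovTerm sR (3 / 2) l x = |(2 : ℝ) ^ (σ * (l.level : ℝ)) * x| ^ (3 / 2 : ℝ) := by
  rw [besovTerm, abs_mul, abs_of_pos (by positivity : (0 : ℝ) < 2 ^ (σ * (l.level : ℝ))),
    Real.mul_rpow (by positivity) (abs_nonneg x), ← Real.rpow_mul (by norm_num), hσ]
  congr 2
  ring

/-- Absolutely summable families are summable to the power `3/2`. -/
lemma summable_abs_rpow_three_halves {ι : Type*} {f : ι → ℝ} (hf : Summable fun i => |f i|) :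
    Summable fun i => |f i| ^ (3 / 2 : ℝ) := by
  refine Summable.of_nonneg_of_le (fun _ => by positivity) (fun i => ?_)
    (hf.mul_left √(∑' i, |f i|))
  rw [abs_rpow_three_halves, pow_succ', Real.sq_sqrt (abs_nonneg _)]
  gcongr
  exact hf.le_tsum i fun _ _ => abs_nonneg _

lemma convergesAtRateSqrt_besov {η ε : ℝ} (hη : 0 ≤ η) (hε : 0 ≤ ε)
    {F : sobolev W (-η) →ₗ[ℝ] L2 d}
    (hF : ∃ C : ℝ≥0, ∀ u, ‖F u‖ₑ ≤ C * besovNorm W (-η) 2 u)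
    (hrg : adjointRange F = (sobolev W η : Set _)) (u₀ : sobolev W (-η))
    (hu₀ : (u₀ : Distr d) ∈ besov W (η + d / 2 + 3 * ε) 1 one_pos) :
    ConvergesAtRateSqrt W F (-η / 3 + ε + d / 6) (3 / 2) (besovNorm W (-η / 3 + ε) 2) u₀ := by
  set σ : ℝ := -η / 3 + ε with hσ
  have hσR : σ = σ + d / 6 - d / 6 := by ring
  have hpos : ∀ l : Index d, (0 : ℝ) < 2 ^ (σ * (l.level : ℝ)) := fun l => by positivity
  set a : Index d → ℝ := fun l => (u₀ : Distr d) (W.fn l) with ha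
  set A : Index d → ℝ := fun l => (2 : ℝ) ^ (σ * (l.level : ℝ)) * a l with hA
  have h1 : Summable fun l : Index d => (2 : ℝ) ^ ((η + 3 * ε) * (l.level : ℝ)) * |a l| := by
    refine (besovPow_lt_top_iff.1 hu₀.2).congr fun l => ?_
    rw [besovTerm, Real.rpow_one]
    congr 2
    ring
  have hA1 : Summable fun l => |A l| := by
    refine Summable.of_nonneg_of_le (fun _ => abs_nonneg _) (fun l => ?_) h1
    rw [hA, abs_mul, abs_of_pos (hpos l)]
    gcongr
    · norm_num
    · linarith
  have hR : Summable fun l => besovTerm (σ + d / 6) (3 / 2) l (a l) := by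
    simpa only [besovTerm_three_halves hσR] using summable_abs_rpow_three_halves hA1
  -- The derivative of the penalty at `u₀`, coefficient by coefficient.
  set ξ : Index d → ℝ := fun l =>
    3 / 2 * (2 : ℝ) ^ (σ * (l.level : ℝ)) * (Real.sign (A l) * √|A l|) with hξ
  have hξ2 : ∀ l, ((2 : ℝ) ^ (η * (l.level : ℝ)) * ξ l) ^ 2 ≤
      9 / 4 * ((2 : ℝ) ^ ((η + 3 * ε) * (l.level : ℝ)) * |a l|) := fun l => by
    have hs : Real.sign (A l) ^ 2 ≤ 1 := by
      rcases Real.sign_apply_eq (A l) with h | h | h <;> rw [h] <;> norm_num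
    -- The exponent balance `2η + 3σ = η + 3ε` is where the source space enters.
    have e : (2 : ℝ) ^ ((η + 3 * ε) * (l.level : ℝ)) =
        ((2 : ℝ) ^ (η * (l.level : ℝ))) ^ 2 * ((2 : ℝ) ^ (σ * (l.level : ℝ))) ^ 3 := by
      rw [← Real.rpow_natCast, ← Real.rpow_natCast, ← Real.rpow_mul (by norm_num),
        ← Real.rpow_mul (by norm_num), ← Real.rpow_add (by norm_num), hσ]
      congr 1
      push_cast
      ring
    have hAl : |A l| = (2 : ℝ) ^ (σ * (l.level : ℝ)) * |a l| := by
      rw [hA, abs_mul, abs_of_pos (hpos l)]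
    calc ((2 : ℝ) ^ (η * (l.level : ℝ)) * ξ l) ^ 2
        = Real.sign (A l) ^ 2 * (9 / 4 * ((2 : ℝ) ^ (η * (l.level : ℝ))) ^ 2 *
            ((2 : ℝ) ^ (σ * (l.level : ℝ))) ^ 2 * √|A l| ^ 2) := by rw [hξ]; ring
      _ ≤ 1 * (9 / 4 * ((2 : ℝ) ^ (η * (l.level : ℝ))) ^ 2 *
            ((2 : ℝ) ^ (σ * (l.level : ℝ))) ^ 2 * √|A l| ^ 2) := by gcongr
      _ = _ := by rw [Real.sq_sqrt (abs_nonneg _), hAl, e]; ring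
  have hξs : Summable fun l : Index d => ((2 : ℝ) ^ (η * (l.level : ℝ)) * ξ l) ^ 2 :=
    Summable.of_nonneg_of_le (fun _ => sq_nonneg _) hξ2 (h1.mul_left _)
  -- Since `η ≥ 0`, the weights are at least `1`, so `ξ` is realized by an `L_2` function.
  have hξ1 : Summable fun l => ξ l ^ 2 := by
    refine Summable.of_nonneg_of_le (fun _ => sq_nonneg _) (fun l => ?_) hξs
    have h : (1 : ℝ) ≤ 2 ^ (η * (l.level : ℝ)) := Real.one_le_rpow one_le_two (by positivity)
    exact (le_mul_of_one_le_left (sq_nonneg _) (one_le_pow₀ h)).trans_eq (mul_pow _ _ 2).symm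
  obtain ⟨f, hf⟩ := exists_ofL2_of_summable_sq (W := W) hξ1
  have hfη : ofL2 f ∈ adjointRange F := by
    rw [hrg]
    refine mem_sobolev_iff.2 ⟨hasWaveletExpansion_ofL2 f, ?_⟩
    simpa only [hf] using hξs
  obtain ⟨w, hw⟩ := exists_hasSum_of_mem_adjointRange (neg_nonpos.2 hη) hF hfη
  refine convergesAtRateSqrt_of_coeff (besovPow_lt_top_iff.2 hR) hw fun M => ?_
  -- `m` bounds the terms of both `b` and `u₀`; the `1` allows passing from `y³ ≤ m` to `y ≤ m`.
  set m : ℝ := max 1 (max M (∑' l, besovTerm (σ + d / 6) (3 / 2) l (a l))) with hm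
  have hm1 : 1 ≤ m := le_max_left _ _
  have hroot : ∀ x : ℝ, |x| ^ (3 / 2 : ℝ) ≤ m → √|x| ≤ m := fun x hx => by
    rw [abs_rpow_three_halves] at hx
    by_contra! h
    have : √|x| ≤ √|x| ^ 3 := le_self_pow₀ (hm1.trans h.le) (by norm_num)
    linarith
  refine ⟨4 * m, by positivity, fun l b hb => ?_⟩
  have hB := hroot ((2 : ℝ) ^ (σ * (l.level : ℝ)) * b) <| by
    rw [← besovTerm_three_halves hσR]
    exact hb.trans ((le_max_left _ _).trans (le_max_right _ _))
  have hAl := hroot (A l) <| by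
    rw [hA, ← besovTerm_three_halves hσR]
    exact (hR.le_tsum l fun _ _ => besovTerm_nonneg _ _ _ _).trans
      ((le_max_right _ _).trans (le_max_right _ _))
  have := sq_le_bregman_three_halves hAl hB
  rw [besovTerm_two, besovTerm_three_halves hσR, besovTerm_three_halves hσR, hf]
  convert! this using 1
  · rw [hA]; ring
  · rw [hξ, hA]; ring

/-! ### Strictness of the embeddings -/

/-- The index of a mother wavelet at level `j` and position `0`. -/
def centralIndex (hd : 0 < d) (j : ℕ) : Index d :=
  Sum.inr (j, ⟨0, Nat.sub_pos_of_lt (Nat.one_lt_two_pow hd.ne')⟩, 0)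

lemma centralIndex_injective (hd : 0 < d) : Function.Injective (centralIndex hd) := by
  intro i j h
  simpa [centralIndex] using h

lemma abs_inner_toLp_le (f g : 𝓢(Pt d, ℝ)) :
    |inner ℝ (f.toLp 2 : L2 d) (g.toLp 2)| ≤ (∫ x, ‖f x‖) * SchwartzMap.seminorm ℝ 0 0 g := by
  have e : inner ℝ (f.toLp 2 : L2 d) (g.toLp 2) = ∫ x, g x * f x := by
    rw [L2.inner_def]
    refine integral_congr_ae ?_
    filter_upwards [f.coeFn_toLp 2, g.coeFn_toLp 2] with x hf hg
    rw [hf, hg]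
    rfl
  rw [e, ← integral_mul_const, ← Real.norm_eq_abs]
  refine norm_integral_le_of_norm_le (f.integrable.norm.mul_const _)
    (Filter.Eventually.of_forall fun x => ?_)
  rw [norm_mul, mul_comm]
  gcongr
  exact g.norm_le_seminorm ℝ x

/-- The `L_2` normalization `2^{jd/2}` meets the Jacobian `2^{-jd}`. The resulting `L_1` decay makes
bounded lacunary series converge as distributions, with no use of vanishing moments. -/
lemma integral_norm_dilate_zero (f : 𝓢(Pt d, ℝ)) (j : ℕ) :
    ∫ x, ‖dilate f j 0 x‖ = ((2 : ℝ) ^ (-(d : ℝ) / 2)) ^ j * ∫ x, ‖f x‖ := by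
  have h0 : intPt (0 : Fin d → ℤ) = 0 := by ext i; simp [intPt]
  simp_rw [dilate_apply, h0, sub_zero, norm_mul]
  rw [integral_const_mul, Measure.integral_comp_smul_of_nonneg volume (fun x => ‖f x‖) _
    (hR := by positivity), finrank_euclideanSpace_fin, smul_eq_mul, ← mul_assoc,
    Real.norm_of_nonneg (by positivity)]
  congr 1
  rw [← Real.rpow_natCast, ← Real.rpow_natCast, ← Real.rpow_natCast, ← Real.rpow_mul (by norm_num),
    ← Real.rpow_mul (by norm_num), ← Real.rpow_neg (by norm_num), ← Real.rpow_add (by norm_num)]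
  congr 1
  ring

lemma exists_abs_inner_centralIndex_le (W : WaveletSystem d) (hd : 0 < d) :
    ∃ C r : ℝ, 0 ≤ C ∧ 0 ≤ r ∧ r < 1 ∧ ∀ (j : ℕ) (χ : 𝓢(Pt d, ℝ)),
      |inner ℝ ((W.fn (centralIndex hd j)).toLp 2 : L2 d) (χ.toLp 2)| ≤
        C * r ^ j * SchwartzMap.seminorm ℝ 0 0 χ := by
  have hd' : (0 : ℝ) < d := by exact_mod_cast hd
  refine ⟨∫ x, ‖W.mother ⟨0, Nat.sub_pos_of_lt (Nat.one_lt_two_pow hd.ne')⟩ x‖,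
    2 ^ (-(d : ℝ) / 2), by positivity, by positivity,
    Real.rpow_lt_one_of_one_lt_of_neg (by norm_num) (by linarith), fun j χ => ?_⟩
  refine (abs_inner_toLp_le _ χ).trans_eq ?_
  congr 1
  rw [mul_comm]
  exact integral_norm_dilate_zero _ j

/-- A series of tempered distributions that is dominated by a geometric series times a seminorm
converges to a tempered distribution. -/
lemma exists_distr_hasSum {f : ℕ → Distr d} {C r : ℝ} (hC : 0 ≤ C) (hr : 0 ≤ r) (hr1 : r < 1)
    (hb : ∀ (j : ℕ) (χ : 𝓢(Pt d, ℝ)),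
      |f j χ| ≤ C * r ^ j * SchwartzMap.seminorm ℝ 0 0 χ) :
    ∃ u : Distr d, ∀ χ, HasSum (fun j => f j χ) (u χ) := by
  have hb' : ∀ (χ : 𝓢(Pt d, ℝ)) (j : ℕ),
      ‖f j χ‖ ≤ r ^ j * (C * SchwartzMap.seminorm ℝ 0 0 χ) :=
    fun χ j => (hb j χ).trans_eq (by ring)
  have hgeo := summable_geometric_of_lt_one hr hr1
  have hs : ∀ χ : 𝓢(Pt d, ℝ), Summable fun j => f j χ := fun χ =>
    Summable.of_norm_bounded (hgeo.mul_right _) (hb' χ)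
  have hbd : ∀ χ : 𝓢(Pt d, ℝ), ‖∑' j, f j χ‖ ≤
      (∑' j, r ^ j) * C * (({0} : Finset (ℕ × ℕ)).sup (schwartzSeminormFamily ℝ (Pt d) ℝ)) χ :=
    fun χ => by
      rw [Finset.sup_singleton, mul_assoc]
      exact tsum_of_norm_bounded (hgeo.hasSum.mul_right _) (hb' χ)
  exact ⟨SchwartzMap.mkCLMtoNormedSpace (σ := RingHom.id ℝ) (fun χ => ∑' j, f j χ)
    (fun χ χ' => by simp_rw [map_add]; exact (hs χ).tsum_add (hs χ'))
    (fun a χ => by simp_rw [map_smul, smul_eq_mul, tsum_mul_left]; rfl)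
    ⟨{0}, (∑' j, r ^ j) * C, mul_nonneg (tsum_nonneg fun j => pow_nonneg hr j) hC, hbd⟩,
    fun χ => (hs χ).hasSum⟩

/-- The lacunary wavelet series `∑_j c_j ψ_{(j,0)}` with bounded coefficients is a tempered
distribution. -/
lemma exists_lacunary (W : WaveletSystem d) (hd : 0 < d) {c : ℕ → ℝ} (hc : ∀ j, |c j| ≤ 1) :
    ∃ u : Distr d, HasWaveletExpansion W u ∧ (∀ j, u (W.fn (centralIndex hd j)) = c j) ∧
      ∀ l ∉ Set.range (centralIndex hd), u (W.fn l) = 0 := by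
  classical
  obtain ⟨C, r, hC, hr, hr1, hb⟩ := exists_abs_inner_centralIndex_le W hd
  obtain ⟨u, hu⟩ := exists_distr_hasSum
    (f := fun j => c j • ofL2 ((W.fn (centralIndex hd j)).toLp 2)) hC hr hr1 fun j χ => by
      rw [smul_apply, smul_eq_mul, abs_mul]
      exact (mul_le_of_le_one_left (abs_nonneg _) (hc j)).trans (hb j χ)
  simp only [smul_apply, smul_eq_mul, ofL2_apply] at hu
  have h1 : ∀ j, u (W.fn (centralIndex hd j)) = c j := fun j => by
    refine (hu _).unique ?_
    convert! hasSum_ite_eq j (c j) using 2 with i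
    simp [inner_fn_fn, (centralIndex_injective hd).eq_iff]
    grind
  have h2 : ∀ l ∉ Set.range (centralIndex hd), u (W.fn l) = 0 := fun l hl => by
    refine (hu _).unique ?_
    convert! hasSum_zero using 2 with j
    rw [inner_fn_fn, if_neg fun h => hl ⟨j, h⟩, mul_zero]
  refine ⟨u, fun χ => ?_, h1, h2⟩
  rw [← (centralIndex_injective hd).hasSum_iff fun l hl => by rw [h2 l hl, zero_mul]]
  simp only [Function.comp_def, h1]
  exact hu χ

lemma lacunary_besovPow_lt_top_iff {hd : 0 < d} {s p : ℝ} (hp : 0 < p) {c : ℕ → ℝ} {u : Distr d}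
    (h1 : ∀ j, u (W.fn (centralIndex hd j)) = c j)
    (h2 : ∀ l ∉ Set.range (centralIndex hd), u (W.fn l) = 0) :
    besovPow W s p u < ∞ ↔ Summable fun j => besovTerm s p (centralIndex hd j) (c j) := by
  rw [besovPow_lt_top_iff, ← (centralIndex_injective hd).summable_iff fun l hl => by
    rw [h2 l hl, besovTerm, abs_zero, Real.zero_rpow hp.ne', mul_zero]]
  simp only [Function.comp_def, h1]

lemma level_centralIndex (hd : 0 < d) (j : ℕ) : (centralIndex hd j).level = j := rfl

lemma summable_two_rpow_mul {t : ℝ} (ht : t < 0) :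
    Summable fun j : ℕ => (2 : ℝ) ^ (t * (j : ℝ)) := by
  simp_rw [Real.rpow_mul zero_le_two, Real.rpow_natCast]
  exact summable_geometric_of_lt_one (by positivity)
    (Real.rpow_lt_one_of_one_lt_of_neg (by norm_num) ht)

/-- The lacunary series with all coefficients `1` has `H^s` terms `2^{2sj}`, summable for `s < 0`
but not for `s = 0`. -/
lemma sobolev_zero_lt (W : WaveletSystem d) (hd : 0 < d) {s : ℝ} (hs : s < 0) :
    sobolev W 0 < sobolev W s := by
  refine lt_of_le_of_ne (contEmbeds_of_le two_pos hs.le).1 fun h => ?_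
  obtain ⟨u, hu, h1, h2⟩ := exists_lacunary W hd (c := fun _ => 1) (by simp)
  have hus : u ∈ sobolev W s := by
    refine ⟨hu, (lacunary_besovPow_lt_top_iff two_pos h1 h2).2 ?_⟩
    refine (summable_two_rpow_mul (by linarith : s * 2 < 0)).congr fun j => ?_
    rw [besovTerm_two, mul_one, level_centralIndex, ← Real.rpow_natCast,
      ← Real.rpow_mul zero_le_two]
    congr 1
    push_cast
    ring
  rw [← h] at hus
  have := (lacunary_besovPow_lt_top_iff two_pos h1 h2).1 hus.2
  simp [besovTerm_two, summable_const_iff] at this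

/-- The coefficients `2^{-(t-d/2)j}` make every `B_1^t` term equal to `1`, while the `H^s` terms
`2^{2(s+d/2-t)j}` decay geometrically. They are at most `1` because `s ≥ 0` forces `t > d/2`. -/
lemma besov_one_lt_sobolev (W : WaveletSystem d) (hd : 0 < d) {s t : ℝ} (hs : 0 ≤ s)
    (hst : s + d / 2 < t) : besov W t 1 one_pos < sobolev W s := by
  refine lt_of_le_of_ne (contEmbeds_one_two hst.le).1 fun h => ?_
  obtain ⟨u, hu, h1, h2⟩ := exists_lacunary W hd (c := fun j => 2 ^ (-(t - d / 2) * (j : ℝ)))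
    fun j => by
      rw [abs_of_pos (by positivity)]
      refine Real.rpow_le_one_of_one_le_of_nonpos (by norm_num)
        (mul_nonpos_of_nonpos_of_nonneg (by linarith) (by positivity))
  have hus : u ∈ sobolev W s := by
    refine ⟨hu, (lacunary_besovPow_lt_top_iff two_pos h1 h2).2 ?_⟩
    refine (summable_two_rpow_mul (by linarith : (s + d / 2 - t) * 2 < 0)).congr fun j => ?_
    rw [besovTerm_two, level_centralIndex, ← Real.rpow_add two_pos, ← Real.rpow_natCast,
      ← Real.rpow_mul zero_le_two]
    congr 1
    push_cast
    ring
  rw [← h] at hus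
  have := (lacunary_besovPow_lt_top_iff one_pos h1 h2).1 hus.2
  refine one_ne_zero (α := ℝ) ((summable_const_iff (β := ℕ) 1).1 (this.congr fun j => ?_))
  rw [besovTerm, level_centralIndex, Real.rpow_one, abs_of_pos (by positivity),
    ← Real.rpow_add two_pos, ← Real.rpow_zero 2]
  congr 1
  ring

/-! ### Parameters -/

lemma isGreatest_guaranteedSmoothness (d : ℕ) (sS pS sG pG : ℝ) :
    IsGreatest (guaranteedSmoothness d sS pS sG pG)
      (rateSmoothness d (maxPenaltySmoothness sS pS sG pG) (penaltyIntegrability pS pG)) := by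
  refine ⟨⟨_, le_rfl, rfl⟩, ?_⟩
  rintro _ ⟨s, hs, rfl⟩
  exact add_le_add_left hs _

end BesovTikhonov

end

theorem mainTheorem6 (d : ℕ) (hd : 0 < d) (W : BesovTikhonov.WaveletSystem d)
    (η ε : ℝ) (hη : 0 < η) (hε : 0 < ε) (hεη : ε < η / 3)
    (F : BesovTikhonov.sobolev W (-η) →ₗ[ℝ] BesovTikhonov.L2 d)
    (hF : ∃ C : NNReal, ∀ u, ‖F u‖ₑ ≤ C * BesovTikhonov.besovNorm W (-η) 2 u)
    (hrg : BesovTikhonov.adjointRange F = (BesovTikhonov.sobolev W η : Set _)) :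
    -- the second source condition is strictly tighter than the first
    (BesovTikhonov.ContEmbeds W (η + d / 2 + 3 * ε) 1 one_pos η 2 two_pos ∧
      BesovTikhonov.besov W (η + d / 2 + 3 * ε) 1 one_pos < BesovTikhonov.sobolev W η) ∧
    -- the loose source space lies in the domain of `F`
    BesovTikhonov.ContEmbeds W η 2 two_pos (-η) 2 two_pos ∧
    -- `H^0` is `L_2`, with the same norm
    ((∀ u, u ∈ BesovTikhonov.sobolev W 0 ↔ BesovTikhonov.l2Norm u < ⊤) ∧
      ∀ u ∈ BesovTikhonov.sobolev W 0,
        BesovTikhonov.besovNorm W 0 2 u = BesovTikhonov.l2Norm u) ∧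
    -- `L_2 = H^0` is strictly smaller than the Sobolev space of the second rate
    (BesovTikhonov.ContEmbeds W 0 2 two_pos (-η / 3 + ε) 2 two_pos ∧
      BesovTikhonov.sobolev W 0 < BesovTikhonov.sobolev W (-η / 3 + ε)) ∧
    -- loose source condition: penalty of `L_2`, rate in `L_2`
    (BesovTikhonov.penaltyIntegrability 2 2 = 2 ∧
      BesovTikhonov.maxPenaltySmoothness η 2 η 2 = 0 ∧
      IsGreatest (BesovTikhonov.guaranteedSmoothness d η 2 η 2) 0 ∧
      ∀ u₀ : BesovTikhonov.sobolev W (-η),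
        (u₀ : BesovTikhonov.Distr d) ∈ BesovTikhonov.sobolev W η →
          BesovTikhonov.ConvergesAtRateSqrt W F 0 2 BesovTikhonov.l2Norm u₀) ∧
    -- tight source condition: penalty of `B^{-η/3+ε+d/6}_{3/2}`, rate in `H^{-η/3+ε}`
    (BesovTikhonov.penaltyIntegrability 1 2 = 3 / 2 ∧
      BesovTikhonov.maxPenaltySmoothness (η + d / 2 + 3 * ε) 1 η 2 = -η / 3 + ε + d / 6 ∧
      IsGreatest (BesovTikhonov.guaranteedSmoothness d (η + d / 2 + 3 * ε) 1 η 2)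
        (-η / 3 + ε) ∧
      ∀ u₀ : BesovTikhonov.sobolev W (-η),
        (u₀ : BesovTikhonov.Distr d) ∈
            BesovTikhonov.besov W (η + d / 2 + 3 * ε) 1 one_pos →
          BesovTikhonov.ConvergesAtRateSqrt W F (-η / 3 + ε + d / 6) (3 / 2)
            (BesovTikhonov.besovNorm W (-η / 3 + ε) 2) u₀) := by
  have hd' : (0 : ℝ) < d := by exact_mod_cast hd
  refine ⟨⟨BesovTikhonov.contEmbeds_one_two (by linarith),
      BesovTikhonov.besov_one_lt_sobolev W hd hη.le (by linarith)⟩,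
    BesovTikhonov.contEmbeds_of_le two_pos (by linarith),
    ⟨fun u => BesovTikhonov.mem_sobolev_zero_iff_l2Norm_lt_top,
      fun u hu => BesovTikhonov.besovNorm_eq_l2Norm hu⟩,
    ⟨BesovTikhonov.contEmbeds_of_le two_pos (by linarith),
      BesovTikhonov.sobolev_zero_lt W hd (by linarith)⟩,
    ⟨?_, ?_, ?_, BesovTikhonov.convergesAtRateSqrt_l2 hη.le hF hrg⟩,
    ⟨?_, ?_, ?_, BesovTikhonov.convergesAtRateSqrt_besov hη.le hε.le hF hrg⟩⟩
  · norm_num [BesovTikhonov.penaltyIntegrability]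
  · simp [BesovTikhonov.maxPenaltySmoothness]
  · convert! BesovTikhonov.isGreatest_guaranteedSmoothness d η 2 η 2 using 1
    norm_num [BesovTikhonov.rateSmoothness, BesovTikhonov.maxPenaltySmoothness,
      BesovTikhonov.penaltyIntegrability]
  · norm_num [BesovTikhonov.penaltyIntegrability]
  · rw [BesovTikhonov.maxPenaltySmoothness]
    ring
  · convert! BesovTikhonov.isGreatest_guaranteedSmoothness d (η + d / 2 + 3 * ε) 1 η 2 using 1
    rw [BesovTikhonov.rateSmoothness, BesovTikhonov.maxPenaltySmoothness,
      BesovTikhonov.penaltyIntegrability]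
    ring
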